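/- Let $G$ be a finite directed graph (without parallel edges). A planar drawing of $G$ represents vertices by distinct points of the plane and edges by simple arcs joining their end vertices, so that no edge passes through another vertex and two edges meet only at common end vertices; it is outerplanar if every vertex lies on the boundary of the unbounded face, and upward if every edge $uv$ is a strictly $y$-monotone curve going upward from $u$ to $v$. $G$ is upward outerplanar if it has a drawing that is both outerplanar and upward. A directed graph is $st$-outerplanar if it is acyclic, has exactly one source and exactly one sink, and its underlying undirected graph has an outerplanar drawing. A $k$-page upward book embedding of $G=(V,E)$ with $|V|=n$ consists of a bijection $\pi\colon V\to\{1,\dots,n\}$ with $\pi(u)<\pi(v)$ for every edge $uv\in E$ and a map $\sigma\colon E\to\{1,\dots,k\}$ such that there are no edges $uv,wx\in E$ with $\sigma(uv)=\sigma(wx)$ and $\pi(u)<\pi(w)<\pi(v)<\pi(x)$. Theorem. Every upward outerplanar graph $G$ each of whose biconnected components (blocks, i.e. maximal connected subgraphs without cut-vertex of their own) is an $st$-outerplanar graph admits an $8$-page upward book embedding. -/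

import Mathlib

/-! ### Drawings in the plane -/

/-- `A` is a simple (Jordan) arc in the plane with end points `p` and `q`. -/
def IsSimpleArc (p q : ℝ × ℝ) (A : Set (ℝ × ℝ)) : Prop :=
  ∃ γ : unitInterval → ℝ × ℝ, Continuous γ ∧ Function.Injective γ ∧
    γ 0 = p ∧ γ 1 = q ∧ Set.range γ = A

/-- `A` is a strictly `y`-monotone curve going upward from `p` to `q`. -/
def IsUpwardArc (p q : ℝ × ℝ) (A : Set (ℝ × ℝ)) : Prop :=
  ∃ γ : unitInterval → ℝ × ℝ, Continuous γ ∧ StrictMono (fun t => (γ t).2) ∧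
    γ 0 = p ∧ γ 1 = q ∧ Set.range γ = A

/-- A planar (crossing-free) drawing of a graph: the vertices are distinct points of the plane,
each edge is a simple arc between its end vertices that contains no other vertex, and two distinct
edges meet only at common end vertices. The value of `arc` is relevant only on edges. -/
structure PlanarDrawing {V : Type*} (G : SimpleGraph V) where
  pos : V → ℝ × ℝ
  arc : Sym2 V → Set (ℝ × ℝ)
  pos_injective : Function.Injective pos
  isSimpleArc : ∀ u v, G.Adj u v → IsSimpleArc (pos u) (pos v) (arc s(u, v))
  mem_of_pos_mem_arc : ∀ e ∈ G.edgeSet, ∀ w, pos w ∈ arc e → w ∈ e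
  arc_inter_arc : ∀ e ∈ G.edgeSet, ∀ f ∈ G.edgeSet, e ≠ f →
    arc e ∩ arc f ⊆ pos '' {w | w ∈ e ∧ w ∈ f}

namespace PlanarDrawing

variable {V : Type*} {G : SimpleGraph V}

/-- The set of points of the plane covered by the drawing. -/
def support (D : PlanarDrawing G) : Set (ℝ × ℝ) :=
  Set.range D.pos ∪ ⋃ e ∈ G.edgeSet, D.arc e

/-- The outer face: the unbounded connected component of the complement of the drawing. -/
def outerFace (D : PlanarDrawing G) : Set (ℝ × ℝ) :=
  {p | p ∈ D.supportᶜ ∧ ¬ Bornology.IsBounded (connectedComponentIn D.supportᶜ p)}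

/-- A drawing is outerplanar if every vertex is on (the boundary of) the outer face. -/
def IsOuterplanar (D : PlanarDrawing G) : Prop :=
  ∀ v, D.pos v ∈ closure D.outerFace

end PlanarDrawing

/-! ### Graphs -/

namespace SimpleGraph

variable {V : Type*}

/-- A graph is outerplanar if it admits an outerplanar drawing. -/
def IsOuterplanar (G : SimpleGraph V) : Prop :=
  ∃ D : PlanarDrawing G, D.IsOuterplanar

/-- A connected graph without cut-vertices (a single vertex and a single edge are allowed). -/
def IsNonseparable (G : SimpleGraph V) : Prop :=
  G.Connected ∧ ∀ c : V, (G.induce {c}ᶜ).Preconnected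

/-- `B` is the vertex set of a block (biconnected component) of `G`, that is, of a maximal
connected subgraph without cut-vertices; such a subgraph is induced by its vertex set. -/
def IsBlock (G : SimpleGraph V) (B : Set V) : Prop :=
  Maximal (fun S : Set V => (G.induce S).IsNonseparable) B

end SimpleGraph

/-! ### Directed graphs -/

namespace Digraph

variable {V : Type*}

/-- The subdigraph induced by a set of vertices. -/
def induceOn (G : Digraph V) (B : Set V) : Digraph B where
  Adj u v := G.Adj u v

/-- No directed cycle. -/
def IsDAG (G : Digraph V) : Prop :=
  ∀ v, ¬ Relation.TransGen G.Adj v v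

/-- A source is a vertex without incoming edges. -/
def IsSource (G : Digraph V) (v : V) : Prop := ∀ u, ¬ G.Adj u v

/-- A sink is a vertex without outgoing edges. -/
def IsSink (G : Digraph V) (v : V) : Prop := ∀ u, ¬ G.Adj v u

/-- A directed acyclic graph with a single source and a single sink. -/
def IsSTDAG (G : Digraph V) : Prop :=
  G.IsDAG ∧ (∃! s, G.IsSource s) ∧ (∃! t, G.IsSink t)

/-- An `st`-outerplanar graph: an `st`-DAG whose underlying graph is outerplanar. -/
def IsSTOuterplanar (G : Digraph V) : Prop :=
  G.IsSTDAG ∧ G.toSimpleGraphInclusive.IsOuterplanar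

/-- A digraph is upward outerplanar if it has an outerplanar drawing in which every edge `uv` is
a `y`-monotone curve going upward from `u` to `v`. In particular it has no loops and no pairs of
opposite edges. -/
def IsUpwardOuterplanar (G : Digraph V) : Prop :=
  ∃ D : PlanarDrawing G.toSimpleGraphInclusive, D.IsOuterplanar ∧
    ∀ u v, G.Adj u v → IsUpwardArc (D.pos u) (D.pos v) (D.arc s(u, v))

/-- A `k`-page upward book embedding: a linear order `π` of the vertices in which each edge goes
forward, and an assignment `σ` of the edges to `k` pages such that no two edges on the same page
cross, i.e. have interleaving end vertices. -/
structure UpwardBookEmbedding [Fintype V] (G : Digraph V) (k : ℕ) where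
  π : V ≃ Fin (Fintype.card V)
  σ : {e : V × V // G.Adj e.1 e.2} → Fin k
  lt_of_adj : ∀ u v, G.Adj u v → π u < π v
  not_cross : ∀ e f : {e : V × V // G.Adj e.1 e.2}, σ e = σ f →
    ¬ (π e.1.1 < π f.1.1 ∧ π f.1.1 < π e.1.2 ∧ π e.1.2 < π f.1.2)

end Digraph

/-! Blocks. In an upward drawing of a block with one source `s` and one sink `t`, every vertex lies
on a directed `s`-`t` path. If edges passed a vertex both on its left and on its right, they would
extend to two `s`-`t` paths enclosing it, against outerplanarity; so each vertex is leftmost or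
rightmost at its height (`isLeftmost_or_mirror`, `notMem_closure_of_enclosed`). By the intermediate
value theorem each side is then a chain for reachability, edges within a side do not interleave, and
edges between the sides are ordered consistently. `hasLocalLayout_of_two_sided` turns this into four
pages: one for the inner edges of each side and two for the edges between the sides. A vertex avoids
the inner page of the opposite side, so it meets at most three pages.

Gluing. When a piece is inserted contiguously at a cut vertex `c`, an old edge and a new one can
cross only if the old edge ends at `c` and the new one passes over `c`. The new edges at `c` go on
page `0`; those passing over `c` must avoid page `0` and the at most three other pages already used
at `c`. Four pages remain for the block, and 1 + 3 + 4 = 8. The invariant `IsRootedLayout` carries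
this through the recursion `exists_isRootedLayout`, which splits vertex sets until they are
nonseparable. -/

/-! ### Gluing layouts at a cut vertex -/

section Gluing

variable {V : Type*}

/-- An upward layout of the subgraph induced by `S`, with vertices placed at the points `p v` of a
line and edges assigned to the pages `σ u v`. -/
structure IsUpwardLayout {κ : Type*} (E : V → V → Prop) (S : Set V) (p : V → ℝ) (σ : V → V → κ) :
    Prop where
  injOn : Set.InjOn p S
  lt : ∀ u ∈ S, ∀ v ∈ S, E u v → p u < p v
  not_cross : ∀ a ∈ S, ∀ b ∈ S, ∀ c ∈ S, ∀ d ∈ S, E a c → E b d → σ a c = σ b d →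
    p a < p b → p b < p c → p c < p d → False

/-- The subgraph induced by `S` has a `4`-page upward layout in which each vertex is avoided by
one of the pages. -/
def HasLocalLayout (E : V → V → Prop) (S : Set V) : Prop :=
  ∃ (p : V → ℝ) (σ : V → V → Fin 4), IsUpwardLayout E S p σ ∧
    ∀ w ∈ S, ∃ i, ∀ u ∈ S, ∀ v ∈ S, E u v → u = w ∨ v = w → σ u v ≠ i

/-- An `8`-page upward layout of the subgraph induced by `S` in which the edges at the root `r`
are on page `0`, the edges passing over `r` avoid page `0` and the pages in `A`, and every other
vertex meets at most three pages other than `0`. -/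
structure IsRootedLayout (E : V → V → Prop) (S : Set V) (r : V) (A : Finset (Fin 8))
    (p : V → ℝ) (σ : V → V → Fin 8) : Prop extends IsUpwardLayout E S p σ where
  root : ∀ u ∈ S, ∀ v ∈ S, E u v → u = r ∨ v = r → σ u v = 0
  passing : ∀ u ∈ S, ∀ v ∈ S, E u v → p u < p r → p r < p v → σ u v ≠ 0 ∧ σ u v ∉ A
  few : ∀ w ∈ S, w ≠ r → ∃ A' : Finset (Fin 8), A'.card ≤ 3 ∧
    ∀ u ∈ S, ∀ v ∈ S, E u v → u = w ∨ v = w → σ u v = 0 ∨ σ u v ∈ A'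

lemma HasLocalLayout.mono {E : V → V → Prop} {S T : Set V} (h : HasLocalLayout E T)
    (hST : S ⊆ T) : HasLocalLayout E S := by
  obtain ⟨p, σ, h, hw⟩ := h
  refine ⟨p, σ, ⟨h.injOn.mono hST, fun u hu v hv => h.lt u (hST hu) v (hST hv), ?_⟩, ?_⟩
  · intro a ha b hb c hc d hd
    exact h.not_cross a (hST ha) b (hST hb) c (hST hc) d (hST hd)
  · intro w hw'
    obtain ⟨i, hi⟩ := hw w (hST hw')
    exact ⟨i, fun u hu v hv => hi u (hST hu) v (hST hv)⟩

lemma HasLocalLayout.exists_isRootedLayout {E : V → V → Prop} {S : Set V}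
    (h : HasLocalLayout E S) (r : V) (A : Finset (Fin 8)) (hA : A.card ≤ 3) :
    ∃ p σ, IsRootedLayout E S r A p σ := by
  classical
  obtain ⟨p, σ, h, hw⟩ := h
  -- Of the eight pages, at least 8 - (1 + 3) = 4 lie outside `insert 0 A`, enough to host the local
  -- layout.
  obtain ⟨g⟩ : Nonempty (Fin 4 ↪ {x : Fin 8 // x ∉ insert 0 A}) := by
    apply Function.Embedding.nonempty_of_card_le
    have h1 := Fintype.card_subtype_compl (fun x : Fin 8 => x ∈ insert 0 A)
    have h2 := Finset.card_insert_le 0 A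
    rw [h1, Fintype.card_coe]
    simp only [Fintype.card_fin]
    omega
  have hg0 : ∀ i, (g i : Fin 8) ≠ 0 ∧ (g i : Fin 8) ∉ A := fun i => by
    have := (g i).2
    rw [Finset.mem_insert, not_or] at this
    exact this
  refine ⟨p, fun u v => if u = r ∨ v = r then 0 else g (σ u v), ⟨⟨h.injOn, h.lt, ?_⟩, ?_, ?_, ?_⟩⟩
  · intro a ha b hb c hc d hd hac hbd hσ h1 h2 h3
    by_cases hr : a = r ∨ c = r <;> by_cases hr' : b = r ∨ d = r
    -- Two edges at `r` share an end, so they cannot interleave.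
    · rcases hr with rfl | rfl <;> rcases hr' with rfl | rfl <;> linarith
    · simp only [hr, hr', if_true, if_false] at hσ
      exact (hg0 _).1 hσ.symm
    · simp only [hr, hr', if_true, if_false] at hσ
      exact (hg0 _).1 hσ
    · simp only [hr, hr', if_false] at hσ
      exact h.not_cross a ha b hb c hc d hd hac hbd (g.injective (Subtype.ext hσ)) h1 h2 h3
  · intro u _ v _ _ huv
    simp only [huv, if_true]
  · intro u _ v _ _ h1 h2
    have : ¬ (u = r ∨ v = r) := by
      rintro (rfl | rfl) <;> exact lt_irrefl _ (by assumption)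
    simp only [this, if_false]
    exact hg0 _
  · intro w hwS _
    obtain ⟨i, hi⟩ := hw w hwS
    refine ⟨(Finset.univ.erase i).image fun j => (g j : Fin 8), ?_, ?_⟩
    · refine Finset.card_image_le.trans ?_
      simp
    · intro u hu v hv huv hw
      by_cases hr : u = r ∨ v = r
      · left; simp only [hr, if_true]
      · right
        simp only [hr, if_false]
        exact Finset.mem_image_of_mem _ (Finset.mem_erase.2 ⟨hi u hu v hv huv hw, Finset.mem_univ _⟩)

/-- Two line arrangements of sets `S`, `T` that share only `c` can be combined so that `T` is
contiguous around `c`. -/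
lemma exists_insert_around [Finite V] (S T : Set V) (c : V) (hST : S ∩ T = {c}) (p₁ p₂ : V → ℝ)
    (h₁ : Set.InjOn p₁ S) :
    ∃ p : V → ℝ, (∀ v ∈ S, p v = p₁ v) ∧ (∀ u ∈ T, ∀ v ∈ T, p u < p v ↔ p₂ u < p₂ v) ∧
      (∀ u ∈ S, u ≠ c → ∀ v ∈ T, (p u < p v ↔ p u < p c) ∧ (p v < p u ↔ p c < p u)) := by
  classical
  have hc : c ∈ S ∩ T := hST ▸ rfl
  -- `T` is shrunk by `ε` around `p₁ c` until it fits into the gap between `c` and every other point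
  -- of `S`.
  obtain ⟨ε, hε, hlt⟩ : ∃ ε > 0, ∀ u ∈ S, u ≠ c → ∀ v, ε * |p₂ v - p₂ c| < |p₁ u - p₁ c| := by
    have key : ∀ᶠ ε in nhdsWithin (0 : ℝ) (Set.Ioi 0),
        ∀ u, u ∈ S → u ≠ c → ∀ v, ε * |p₂ v - p₂ c| < |p₁ u - p₁ c| := by
      rw [Filter.eventually_all]
      intro u
      by_cases hu : u ∈ S ∧ u ≠ c
      · have hpos : 0 < |p₁ u - p₁ c| :=
          abs_pos.2 (sub_ne_zero.2 fun h => hu.2 (h₁ hu.1 hc.1 h))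
        simp only [hu.1, hu.2, ne_eq, not_false_eq_true, forall_const]
        rw [Filter.eventually_all]
        intro v
        apply Filter.Eventually.filter_mono nhdsWithin_le_nhds
        have : Filter.Tendsto (fun ε : ℝ => ε * |p₂ v - p₂ c|) (nhds 0) (nhds 0) := by
          have := (continuous_mul_const |p₂ v - p₂ c|).tendsto (0 : ℝ)
          simpa using this
        exact this.eventually (gt_mem_nhds hpos)
      · refine Filter.Eventually.of_forall fun ε h h' => absurd ⟨h, h'⟩ hu
    obtain ⟨ε, h, hε⟩ := (key.and self_mem_nhdsWithin).exists
    exact ⟨ε, hε, h⟩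
  have hS : ∀ v ∈ S, v ∈ T → v = c := fun v hv hv' => by
    have : v ∈ S ∩ T := ⟨hv, hv'⟩
    rwa [hST] at this
  let p : V → ℝ := fun v => if v ∈ S then p₁ v else p₁ c + ε * (p₂ v - p₂ c)
  have hpS : ∀ v ∈ S, p v = p₁ v := fun v hv => if_pos hv
  have hpT : ∀ v ∈ T, p v = p₁ c + ε * (p₂ v - p₂ c) := fun v hv => by
    by_cases hv' : v ∈ S
    · obtain rfl := hS v hv' hv
      simp [p, hv']
    · simp [p, hv']
  refine ⟨p, hpS, ?_, ?_⟩
  · intro u hu v hv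
    rw [hpT u hu, hpT v hv, add_lt_add_iff_left, mul_lt_mul_iff_right₀ hε, sub_lt_sub_iff_right]
  · intro u hu huc v hv
    have h := hlt u hu huc v
    rw [hpS u hu, hpT v hv, hpS c hc.1]
    rw [← abs_of_pos hε, ← abs_mul, lt_abs] at h
    have h3 := neg_abs_le (ε * (p₂ v - p₂ c))
    have h4 := le_abs_self (ε * (p₂ v - p₂ c))
    have h5 := abs_nonneg (ε * (p₂ v - p₂ c))
    rcases h with h | h <;> constructor <;> constructor <;> intro h' <;> linarith

/-- Because `T` is contiguous around `c`, an edge of `S` not ending at `c` has both ends outside the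
range of `T` and cannot interleave with an edge of `T`. For the edges of `S` at `c`, `hB` confines
the pages to `0` and `B`, which the edges of `T` passing over `c` avoid. At `c` the piece `T` adds
only page `0`, so the bound of three other pages survives. If `c = r`, taking `A = B` makes the
edges of `T` over the root avoid `A` as well. -/
lemma IsRootedLayout.glue [Finite V] {E : V → V → Prop} {S T : Set V} {c r : V}
    {A B : Finset (Fin 8)} {p₁ p₂ : V → ℝ} {σ₁ σ₂ : V → V → Fin 8}
    (h₁ : IsRootedLayout E S r A p₁ σ₁) (h₂ : IsRootedLayout E T c B p₂ σ₂)
    (hST : S ∩ T = {c}) (hr : r ∈ S)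
    (hE : ∀ u v, E u v → u ∈ S ∪ T → v ∈ S ∪ T → (u ∈ S ∧ v ∈ S) ∨ (u ∈ T ∧ v ∈ T))
    (hirr : ∀ v, ¬ E v v) (hA : c = r → A = B)
    (hB : ∀ u ∈ S, ∀ v ∈ S, E u v → u = c ∨ v = c → σ₁ u v = 0 ∨ σ₁ u v ∈ B) :
    ∃ p σ, IsRootedLayout E (S ∪ T) r A p σ := by
  classical
  obtain ⟨p, hpS, hpT, hpc⟩ := exists_insert_around S T c hST p₁ p₂ h₁.injOn
  have hc : c ∈ S ∩ T := hST ▸ rfl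
  have hS : ∀ v ∈ S, v ∈ T → v = c := fun v hv hv' => by
    have : v ∈ S ∩ T := ⟨hv, hv'⟩
    rwa [hST] at this
  let σ : V → V → Fin 8 := fun u v => if u ∈ S ∧ v ∈ S then σ₁ u v else σ₂ u v
  have hσS : ∀ u ∈ S, ∀ v ∈ S, σ u v = σ₁ u v := fun u hu v hv => if_pos ⟨hu, hv⟩
  have hσT : ∀ u ∈ T, ∀ v ∈ T, E u v → σ u v = σ₂ u v := fun u hu v hv huv => by
    refine if_neg fun h => hirr c ?_
    have h1 := hS u h.1 hu
    have h2 := hS v h.2 hv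
    rwa [h1, h2] at huv
  have hover : ∀ u ∈ T, ∀ v ∈ T, E u v → p u < p c → p c < p v → σ u v ≠ 0 ∧ σ u v ∉ B := by
    intro u hu v hv huv h h'
    rw [hσT u hu v hv huv]
    exact h₂.passing u hu v hv huv ((hpT _ hu _ hc.2).1 h) ((hpT _ hc.2 _ hv).1 h')
  have hat : ∀ u ∈ S, ∀ v ∈ S, E u v → u = c ∨ v = c → σ u v = 0 ∨ σ u v ∈ B := by
    intro u hu v hv huv h
    rw [hσS u hu v hv]
    exact hB u hu v hv huv h
  refine ⟨p, σ, ⟨⟨?_, ?_, ?_⟩, ?_, ?_, ?_⟩⟩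
  · have hTinj : ∀ u ∈ T, ∀ v ∈ T, p u = p v → u = v := fun u hu v hv h => by
      refine h₂.injOn hu hv (le_antisymm ?_ ?_)
      · exact not_lt.1 fun h' => ((hpT v hv u hu).2 h').ne' h
      · exact not_lt.1 fun h' => ((hpT u hu v hv).2 h').ne h
    have hSinj : ∀ u ∈ S, ∀ v ∈ S, p u = p v → u = v := fun u hu v hv h => by
      rw [hpS u hu, hpS v hv] at h
      exact h₁.injOn hu hv h
    have hmix : ∀ u ∈ S, ∀ v ∈ T, p u = p v → u = v := fun u hu v hv h => by
      by_cases huc : u = c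
      · exact hTinj u (huc ▸ hc.2) v hv h
      · have h1 := hpc u hu huc v hv
        rw [h] at h1
        refine absurd (hSinj u hu c hc.1 (h.trans (le_antisymm ?_ ?_))) huc
        · exact not_lt.1 fun h' => lt_irrefl _ (h1.2.2 h')
        · exact not_lt.1 fun h' => lt_irrefl _ (h1.1.2 h')
    rintro u (hu | hu) v (hv | hv) h
    · exact hSinj u hu v hv h
    · exact hmix u hu v hv h
    · exact (hmix v hv u hu h.symm).symm
    · exact hTinj u hu v hv h
  · intro u hu v hv huv
    rcases hE u v huv hu hv with ⟨hu, hv⟩ | ⟨hu, hv⟩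
    · rw [hpS u hu, hpS v hv]
      exact h₁.lt u hu v hv huv
    · exact (hpT u hu v hv).2 (h₂.lt u hu v hv huv)
  · intro a ha b hb c' hc' d hd hac hbd hσ h1 h2 h3
    rcases hE a c' hac ha hc' with ⟨ha, hc'⟩ | ⟨ha, hc'⟩ <;>
      rcases hE b d hbd hb hd with ⟨hb, hd⟩ | ⟨hb, hd⟩
    · rw [hσS a ha c' hc', hσS b hb d hd] at hσ
      simp only [hpS _ ha, hpS _ hb, hpS _ hc', hpS _ hd] at h1 h2 h3
      exact h₁.not_cross a ha b hb c' hc' d hd hac hbd hσ h1 h2 h3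
    · by_cases hcc : c' = c
      · subst hcc
        have h4 := hat a ha c' hc' hac (Or.inr rfl)
        have h5 := hover b hb d hd hbd h2 h3
        rw [hσ] at h4
        tauto
      · have h4 := hpc c' hc' hcc
        have h5 := (h4 d hd).1.1 h3
        have h6 := (h4 b hb).2.1 h2
        linarith
    · by_cases hcb : b = c
      · subst hcb
        have h4 := hat b hb d hd hbd (Or.inl rfl)
        have h5 := hover a ha c' hc' hac h1 h2
        rw [← hσ] at h4
        tauto
      · have h4 := hpc b hb hcb
        have h5 := (h4 a ha).2.1 h1
        have h6 := (h4 c' hc').1.1 h2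
        linarith
    · rw [hσT a ha c' hc' hac, hσT b hb d hd hbd] at hσ
      rw [hpT _ ha _ hb] at h1
      rw [hpT _ hb _ hc'] at h2
      rw [hpT _ hc' _ hd] at h3
      exact h₂.not_cross a ha b hb c' hc' d hd hac hbd hσ h1 h2 h3
  · intro u hu v hv huv h
    rcases hE u v huv hu hv with ⟨hu, hv⟩ | ⟨hu, hv⟩
    · rw [hσS u hu v hv]
      exact h₁.root u hu v hv huv h
    · rw [hσT u hu v hv huv]
      refine h₂.root u hu v hv huv ?_
      rcases h with rfl | rfl
      · exact Or.inl (hS _ hr hu)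
      · exact Or.inr (hS _ hr hv)
  · intro u hu v hv huv h h'
    rcases hE u v huv hu hv with ⟨hu, hv⟩ | ⟨hu, hv⟩
    · rw [hσS u hu v hv]
      rw [hpS u hu, hpS r hr] at h
      rw [hpS r hr, hpS v hv] at h'
      exact h₁.passing u hu v hv huv h h'
    · by_cases hcr : c = r
      · subst hcr
        rw [hA rfl]
        exact hover u hu v hv huv h h'
      · have h4 := hpc r hr (Ne.symm hcr)
        have h5 := (h4 u hu).2.1 h
        have h6 := (h4 v hv).1.1 h'
        linarith
  · intro w hw hwr
    by_cases hwS : w ∈ S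
    · obtain ⟨A', hA', h⟩ := h₁.few w hwS hwr
      refine ⟨A', hA', fun u hu v hv huv hw => ?_⟩
      rcases hE u v huv hu hv with ⟨hu, hv⟩ | ⟨hu, hv⟩
      · rw [hσS u hu v hv]
        exact h u hu v hv huv hw
      · left
        rw [hσT u hu v hv huv]
        refine h₂.root u hu v hv huv ?_
        rcases hw with rfl | rfl
        · exact Or.inl (hS _ hwS hu)
        · exact Or.inr (hS _ hwS hv)
    · have hwT : w ∈ T := hw.resolve_left hwS
      obtain ⟨A', hA', h⟩ := h₂.few w hwT (fun h => hwS (h ▸ hc.1))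
      refine ⟨A', hA', fun u hu v hv huv hw => ?_⟩
      rcases hE u v huv hu hv with ⟨hu, hv⟩ | ⟨hu, hv⟩
      · rcases hw with rfl | rfl <;> contradiction
      · rw [hσT u hu v hv huv]
        exact h u hu v hv huv hw

lemma IsRootedLayout.disjoint_union [Finite V] {E : V → V → Prop} {S T : Set V} {r r' : V}
    {A B : Finset (Fin 8)} {p₁ p₂ : V → ℝ} {σ₁ σ₂ : V → V → Fin 8}
    (h₁ : IsRootedLayout E S r A p₁ σ₁) (h₂ : IsRootedLayout E T r' B p₂ σ₂)
    (hST : ∀ v ∈ S, v ∉ T) (hr : r ∈ S)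
    (hE : ∀ u v, E u v → u ∈ S ∪ T → v ∈ S ∪ T → (u ∈ S ∧ v ∈ S) ∨ (u ∈ T ∧ v ∈ T)) :
    ∃ p σ, IsRootedLayout E (S ∪ T) r A p σ := by
  classical
  -- All of `T` is shifted to the right of `S`, so no edge of `T` passes over `r`.
  obtain ⟨M, hM⟩ : ∃ M : ℝ, ∀ u v, p₁ u < p₂ v + M := by
    obtain ⟨a, ha⟩ := (Set.finite_range p₁).bddAbove
    obtain ⟨b, hb⟩ := (Set.finite_range p₂).bddBelow
    refine ⟨a - b + 1, fun u v => ?_⟩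
    have h1 := ha (Set.mem_range_self u)
    have h2 := hb (Set.mem_range_self v)
    linarith
  let p : V → ℝ := fun v => if v ∈ S then p₁ v else p₂ v + M
  have hpS : ∀ v ∈ S, p v = p₁ v := fun v hv => if_pos hv
  have hpT : ∀ v ∈ T, p v = p₂ v + M := fun v hv => if_neg fun h => hST v h hv
  have hp : ∀ u ∈ S, ∀ v ∈ T, p u < p v := fun u hu v hv => by
    rw [hpS u hu, hpT v hv]
    exact hM u v
  let σ : V → V → Fin 8 := fun u v => if u ∈ S then σ₁ u v else σ₂ u v
  have hσS : ∀ u ∈ S, ∀ v, σ u v = σ₁ u v := fun u hu v => if_pos hu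
  have hσT : ∀ u ∈ T, ∀ v, σ u v = σ₂ u v := fun u hu v => if_neg fun h => hST u h hu
  refine ⟨p, σ, ⟨⟨?_, ?_, ?_⟩, ?_, ?_, ?_⟩⟩
  · rintro u (hu | hu) v (hv | hv) h
    · rw [hpS u hu, hpS v hv] at h
      exact h₁.injOn hu hv h
    · exact absurd h (hp u hu v hv).ne
    · exact absurd h (hp v hv u hu).ne'
    · rw [hpT u hu, hpT v hv] at h
      exact h₂.injOn hu hv (add_right_cancel h)
  · intro u hu v hv huv
    rcases hE u v huv hu hv with ⟨hu, hv⟩ | ⟨hu, hv⟩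
    · rw [hpS u hu, hpS v hv]
      exact h₁.lt u hu v hv huv
    · rw [hpT u hu, hpT v hv]
      have := h₂.lt u hu v hv huv
      linarith
  · intro a ha b hb c hc d hd hac hbd hσ h1 h2 h3
    rcases hE a c hac ha hc with ⟨ha, hc⟩ | ⟨ha, hc⟩ <;>
      rcases hE b d hbd hb hd with ⟨hb, hd⟩ | ⟨hb, hd⟩
    · rw [hσS a ha, hσS b hb] at hσ
      simp only [hpS _ ha, hpS _ hb, hpS _ hc, hpS _ hd] at h1 h2 h3
      exact h₁.not_cross a ha b hb c hc d hd hac hbd hσ h1 h2 h3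
    · exact (hp c hc b hb).not_gt h2
    · exact (hp b hb a ha).not_gt h1
    · rw [hσT a ha, hσT b hb] at hσ
      simp only [hpT _ ha, hpT _ hb, hpT _ hc, hpT _ hd, add_lt_add_iff_right] at h1 h2 h3
      exact h₂.not_cross a ha b hb c hc d hd hac hbd hσ h1 h2 h3
  · intro u hu v hv huv h
    rcases hE u v huv hu hv with ⟨hu, hv⟩ | ⟨hu, hv⟩
    · rw [hσS u hu v]
      exact h₁.root u hu v hv huv h
    · rcases h with rfl | rfl
      · exact absurd hu (hST _ hr)
      · exact absurd hv (hST _ hr)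
  · intro u hu v hv huv h h'
    rcases hE u v huv hu hv with ⟨hu, hv⟩ | ⟨hu, hv⟩
    · rw [hσS u hu v]
      rw [hpS u hu, hpS r hr] at h
      rw [hpS r hr, hpS v hv] at h'
      exact h₁.passing u hu v hv huv h h'
    · exact absurd h (hp r hr u hu).not_gt
  · intro w hw hwr
    rcases hw with hw | hw
    · obtain ⟨A', hA', h⟩ := h₁.few w hw hwr
      refine ⟨A', hA', fun u hu v hv huv hw' => ?_⟩
      rcases hE u v huv hu hv with ⟨hu, hv⟩ | ⟨hu, hv⟩
      · rw [hσS u hu v]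
        exact h u hu v hv huv hw'
      · rcases hw' with rfl | rfl
        · exact absurd hu (hST _ hw)
        · exact absurd hv (hST _ hw)
    · by_cases hwr' : w = r'
      -- The root of `T` becomes an ordinary vertex; all its edges are on page `0`.
      · refine ⟨∅, by simp, fun u hu v hv huv hw' => ?_⟩
        rcases hE u v huv hu hv with ⟨hu, hv⟩ | ⟨hu, hv⟩
        · rcases hw' with rfl | rfl
          · exact absurd hw (hST _ hu)
          · exact absurd hw (hST _ hv)
        · rw [hσT u hu v]
          exact Or.inl (h₂.root u hu v hv huv (hwr' ▸ hw'))
      · obtain ⟨A', hA', h⟩ := h₂.few w hw hwr'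
        refine ⟨A', hA', fun u hu v hv huv hw' => ?_⟩
        rcases hE u v huv hu hv with ⟨hu, hv⟩ | ⟨hu, hv⟩
        · rcases hw' with rfl | rfl
          · exact absurd hw (hST _ hu)
          · exact absurd hw (hST _ hv)
        · rw [hσT u hu v]
          exact h u hu v hv huv hw'

/-! ### Decomposition of vertex sets at cut vertices. -/

lemma SimpleGraph.exists_separation {W : Type*} {K : SimpleGraph W} (h : ¬ K.Preconnected)
    (r : W) : ∃ A : Set W, r ∈ A ∧ Aᶜ.Nonempty ∧ ∀ u ∈ A, ∀ v ∉ A, ¬ K.Adj u v := by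
  refine ⟨{w | K.Reachable r w}, SimpleGraph.Reachable.refl r, ?_, ?_⟩
  · by_contra hne
    rw [Set.not_nonempty_iff_eq_empty, Set.compl_empty_iff] at hne
    refine h fun u v => ?_
    have hu : u ∈ {w | K.Reachable r w} := hne ▸ Set.mem_univ u
    have hv : v ∈ {w | K.Reachable r w} := hne ▸ Set.mem_univ v
    exact hu.symm.trans hv
  · intro u hu v hv huv
    exact hv (hu.trans huv.reachable)

/-- A disconnected set is split into unions of components; a connected one is split at a cut vertex
`c`, with `c` put into both parts. The parts need not be connected, so the recursion runs over
arbitrary vertex sets. -/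
lemma SimpleGraph.exists_split_of_not_isNonseparable (H : SimpleGraph V) (S : Set V) (r : V)
    (hr : r ∈ S) (h : ¬ (H.induce S).IsNonseparable) :
    ∃ S₁ S₂ : Set V, S₁ ∪ S₂ = S ∧ r ∈ S₁ ∧ S₁ ≠ S ∧ S₂ ≠ S ∧
      (∀ u ∈ S₁, ∀ v ∈ S₂, H.Adj u v → u ∈ S₂ ∨ v ∈ S₁) ∧
      ((S₂.Nonempty ∧ ∀ v ∈ S₁, v ∉ S₂) ∨ ∃ c, S₁ ∩ S₂ = {c}) := by
  by_cases hconn : (H.induce S).Preconnected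
  · have : Nonempty S := ⟨⟨r, hr⟩⟩
    have h' : ¬ ∀ c : S, ((H.induce S).induce {c}ᶜ).Preconnected := fun h' => h ⟨⟨hconn⟩, h'⟩
    rw [not_forall] at h'
    obtain ⟨c, hc⟩ := h'
    -- The part named `S₁` must contain `r`; if `r` is the cut vertex itself, any other vertex may
    -- designate that part.
    obtain ⟨r', hr'⟩ : ∃ r' : ({c}ᶜ : Set S), r = c ∨ r = r' := by
      by_cases hrc : r = c
      · by_contra hno
        refine hc fun u _ => ?_
        exact absurd ⟨u, Or.inl hrc⟩ hno
      · exact ⟨⟨⟨r, hr⟩, fun h => hrc (congrArg Subtype.val h)⟩, Or.inr rfl⟩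
    obtain ⟨A, hA, ⟨b, hb⟩, hadj⟩ := SimpleGraph.exists_separation hc r'
    refine ⟨{v | v = c ∨ ∃ w ∈ A, (w : V) = v}, {v | v = c ∨ ∃ w ∉ A, (w : V) = v},
      ?_, ?_, ?_, ?_, ?_, Or.inr ⟨c, ?_⟩⟩
    · ext v
      constructor
      · rintro ((rfl | ⟨w, _, rfl⟩) | (rfl | ⟨w, _, rfl⟩))
        · exact c.2
        · exact w.1.2
        · exact c.2
        · exact w.1.2
      · intro hv
        by_cases hvc : v = c
        · exact Or.inl (Or.inl hvc)
        · let w : ({c}ᶜ : Set S) := ⟨⟨v, hv⟩, fun h => hvc (congrArg Subtype.val h)⟩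
          by_cases hw : w ∈ A
          · exact Or.inl (Or.inr ⟨w, hw, rfl⟩)
          · exact Or.inr (Or.inr ⟨w, hw, rfl⟩)
    · rcases hr' with h | h
      · exact Or.inl h
      · exact Or.inr ⟨r', hA, h.symm⟩
    · intro heq
      have : (b : V) ∈ {v | v = (c : V) ∨ ∃ w ∈ A, (w : V) = v} := heq.symm ▸ b.1.2
      rcases this with h | ⟨w, hw, h⟩
      · exact b.2 (Subtype.ext h)
      · obtain rfl : w = b := Subtype.ext (Subtype.ext h)
        exact hb hw
    · intro heq
      have : (r' : V) ∈ {v | v = (c : V) ∨ ∃ w ∉ A, (w : V) = v} := heq.symm ▸ r'.1.2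
      rcases this with h | ⟨w, hw, h⟩
      · exact r'.2 (Subtype.ext h)
      · obtain rfl : w = r' := Subtype.ext (Subtype.ext h)
        exact hw hA
    · rintro u (rfl | ⟨w, hw, rfl⟩) v (rfl | ⟨w', hw', rfl⟩) huv
      · exact Or.inl (Or.inl rfl)
      · exact Or.inl (Or.inl rfl)
      · exact Or.inr (Or.inl rfl)
      · exact absurd huv (hadj w hw w' hw')
    · ext v
      constructor
      · rintro ⟨h | ⟨w, hw, h⟩, h' | ⟨w', hw', h'⟩⟩
        · exact h
        · exact h
        · exact h'
        · obtain rfl : w = w' := Subtype.ext (Subtype.ext (h.trans h'.symm))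
          exact absurd hw hw'
      · intro h
        exact ⟨Or.inl h, Or.inl h⟩
  · obtain ⟨A, hA, ⟨b, hb⟩, hadj⟩ := SimpleGraph.exists_separation hconn ⟨r, hr⟩
    refine ⟨Subtype.val '' A, Subtype.val '' Aᶜ, ?_, ⟨_, hA, rfl⟩, ?_, ?_, ?_,
      Or.inl ⟨⟨b, b, hb, rfl⟩, ?_⟩⟩
    · rw [← Set.image_union, Set.union_compl_self, Set.image_univ, Subtype.range_coe]
    · intro heq
      have : (b : V) ∈ Subtype.val '' A := heq.symm ▸ b.2
      obtain ⟨w, hw, h⟩ := this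
      obtain rfl : w = b := Subtype.ext h
      exact hb hw
    · intro heq
      have : r ∈ Subtype.val '' Aᶜ := heq.symm ▸ hr
      obtain ⟨w, hw, h⟩ := this
      obtain rfl : w = ⟨r, hr⟩ := Subtype.ext h
      exact hw hA
    · rintro _ ⟨u, hu, rfl⟩ _ ⟨v, hv, rfl⟩ huv
      exact absurd huv (hadj u hu v hv)
    · rintro _ ⟨u, hu, rfl⟩ ⟨v, hv, h⟩
      obtain rfl : v = u := Subtype.ext h
      exact hv hu

/-- Local layouts of the nonseparable induced subgraphs combine to a rooted layout. -/
theorem exists_isRootedLayout [Finite V] {E : V → V → Prop} {H : SimpleGraph V}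
    (hH : ∀ u v, E u v → H.Adj u v)
    (hloc : ∀ S : Set V, (H.induce S).IsNonseparable → HasLocalLayout E S) (S : Set V) :
    ∀ r ∈ S, ∀ A : Finset (Fin 8), A.card ≤ 3 → ∃ p σ, IsRootedLayout E S r A p σ := by
  induction hn : S.ncard using Nat.strong_induction_on generalizing S with
  | _ n ih =>
    intro r hr A hA
    by_cases hS : (H.induce S).IsNonseparable
    · exact (hloc S hS).exists_isRootedLayout r A hA
    · obtain ⟨S₁, S₂, hU, hr₁, hne₁, hne₂, hadj, hcase⟩ :=
        H.exists_split_of_not_isNonseparable S r hr hS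
      have hs₁ : S₁ ⊂ S := (hU ▸ Set.subset_union_left).ssubset_of_ne hne₁
      have hs₂ : S₂ ⊂ S := (hU ▸ Set.subset_union_right).ssubset_of_ne hne₂
      have ih₁ := ih S₁.ncard (hn ▸ Set.ncard_lt_ncard hs₁) S₁ rfl
      have ih₂ := ih S₂.ncard (hn ▸ Set.ncard_lt_ncard hs₂) S₂ rfl
      have hE : ∀ u v, E u v → u ∈ S₁ ∪ S₂ → v ∈ S₁ ∪ S₂ →
          (u ∈ S₁ ∧ v ∈ S₁) ∨ (u ∈ S₂ ∧ v ∈ S₂) := by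
        rintro u v huv (hu | hu) (hv | hv)
        · exact Or.inl ⟨hu, hv⟩
        · exact (hadj u hu v hv (hH u v huv)).elim (fun h => Or.inr ⟨h, hv⟩) fun h => Or.inl ⟨hu, h⟩
        · exact (hadj v hv u hu (hH u v huv).symm).elim (fun h => Or.inr ⟨hu, h⟩)
            fun h => Or.inl ⟨h, hv⟩
        · exact Or.inr ⟨hu, hv⟩
      obtain ⟨p₁, σ₁, h₁⟩ := ih₁ r hr₁ A hA
      rcases hcase with ⟨⟨r', hr'⟩, hdisj⟩ | ⟨c, hc⟩
      · obtain ⟨p₂, σ₂, h₂⟩ := ih₂ r' hr' A hA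
        have := h₁.disjoint_union h₂ hdisj hr₁ hE
        rwa [hU] at this
      · have hc' : c ∈ S₁ ∩ S₂ := hc ▸ rfl
        have hirr : ∀ v, ¬ E v v := fun v hv => H.loopless.irrefl v (hH v v hv)
        -- `B` collects the pages other than `0` used at `c`. At the root there are none, and `B =
        -- A` passes the prohibition of `A` on to the second part.
        obtain ⟨B, hB, hAB, hσ⟩ : ∃ B : Finset (Fin 8), B.card ≤ 3 ∧ (c = r → A = B) ∧
            ∀ u ∈ S₁, ∀ v ∈ S₁, E u v → u = c ∨ v = c → σ₁ u v = 0 ∨ σ₁ u v ∈ B := by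
          by_cases hcr : c = r
          · exact ⟨A, hA, fun _ => rfl, fun u hu v hv huv h =>
              Or.inl (h₁.root u hu v hv huv (hcr ▸ h))⟩
          · obtain ⟨B, hB, h⟩ := h₁.few c hc'.1 hcr
            exact ⟨B, hB, fun h => absurd h hcr, h⟩
        obtain ⟨p₂, σ₂, h₂⟩ := ih₂ c hc'.2 B hB
        have := h₁.glue h₂ hc hr₁ hE hirr hAB hσ
        rwa [hU] at this

end Gluing

/-! ### Four-page layouts of two-sided graphs -/

section TwoSided

variable {W : Type*}

lemma Bool.eq_of_ne_of_ne {a b c : Bool} (h : a ≠ b) (h' : c ≠ b) : a = c := by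
  revert a b c
  decide

/-- Each vertex has at most one conflict higher up, so colours can be chosen greedily from the top
downwards. -/
lemma exists_bool_coloring [Finite W] (y : W → ℝ) (C : W → W → Prop)
    (hlt : ∀ u v, C u v → y u < y v) (huniq : ∀ u v v', C u v → C u v' → v = v') :
    ∃ c : W → Bool, ∀ u v, C u v → c u ≠ c v := by
  classical
  have wf : WellFounded fun a b : W => y b < y a := by
    have : IsTrans W fun a b : W => y b < y a := ⟨fun a b c h h' => h'.trans h⟩
    have : Std.Irrefl fun a b : W => y b < y a := ⟨fun a => lt_irrefl _⟩
    exact Finite.wellFounded_of_trans_of_irrefl _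
  let F : ∀ u, (∀ v, y u < y v → Bool) → Bool := fun u rec =>
    if h : ∃ v, C u v then !(rec h.choose (hlt _ _ h.choose_spec)) else true
  refine ⟨wf.fix F, fun u v huv => ?_⟩
  have h : ∃ v, C u v := ⟨v, huv⟩
  rw [wf.fix_eq F u]
  simp only [F, dif_pos h]
  rw [huniq _ _ _ h.choose_spec huv]
  simp

/-- The position of a vertex is the number of vertices with a smaller key; this realises a
lexicographic order on the real line. -/
lemma exists_real_of_linearOrder [Finite W] {α : Type*} [LinearOrder α] (k : W → α) :
    ∃ p : W → ℝ, ∀ u v, p u < p v ↔ k u < k v := by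
  classical
  have := Fintype.ofFinite W
  let p : W → ℕ := fun v => (Finset.univ.filter fun u => k u < k v).card
  have hmono : ∀ u v, k u ≤ k v → p u ≤ p v := fun u v h => by
    refine Finset.card_le_card fun w hw => ?_
    rw [Finset.mem_filter] at hw ⊢
    exact ⟨hw.1, hw.2.trans_le h⟩
  have hlt : ∀ u v, k u < k v → p u < p v := fun u v h => by
    refine Finset.card_lt_card ⟨fun w hw => ?_, fun hsub => ?_⟩
    · rw [Finset.mem_filter] at hw ⊢
      exact ⟨hw.1, hw.2.trans h⟩
    · have := hsub (Finset.mem_filter.2 ⟨Finset.mem_univ u, h⟩)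
      exact lt_irrefl _ (Finset.mem_filter.1 this).2
  refine ⟨fun v => p v, fun u v => ?_⟩
  rw [Nat.cast_lt]
  exact ⟨fun h => not_le.1 fun h' => (hmono v u h').not_gt h, hlt u v⟩

lemma exists_edge_of_reflTransGen {E : W → W → Prop} (side : W → Bool) {b c : W}
    (h : Relation.ReflTransGen E b c) (hbc : side b ≠ side c) :
    ∃ x z, E x z ∧ Relation.ReflTransGen E b x ∧ Relation.ReflTransGen E z c ∧
      side x = side b ∧ side z = side c := by
  induction h using Relation.ReflTransGen.head_induction_on with
  | refl => exact absurd rfl hbc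
  | @head b b' hbb' hb'c ih =>
    by_cases hs : side b = side b'
    · obtain ⟨x, z, hxz, hx, hz, hsx, hsz⟩ := ih (hs ▸ hbc)
      exact ⟨x, z, hxz, .head hbb' hx, hz, hsx.trans hs.symm, hsz⟩
    · refine ⟨b, b', hbb', .refl, hb'c, rfl, ?_⟩
      exact Bool.eq_of_ne_of_ne (Ne.symm hs) (Ne.symm hbc)

/-- A finite acyclic digraph whose vertices are partitioned into two sides, each of them a chain for
reachability, such that edges within a side do not interleave and edges between the sides are
ordered consistently, has a four-page layout in which each vertex is avoided by one page. -/
theorem hasLocalLayout_of_two_sided [Finite W] {E : W → W → Prop} (side : W → Bool) (y : W → ℝ)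
    (hy : ∀ u v, E u v → y u < y v)
    (hinj : ∀ u v, side u = side v → y u = y v → u = v)
    (hreach : ∀ u v, side u = side v → y u < y v → Relation.ReflTransGen E u v)
    (hsame : ∀ a b c d, E a c → E b d → side a = side b → side a = side c → side a = side d →
      y a < y b → y b < y c → y c < y d → False)
    (hcross : ∀ u w u' w', (E u w ∨ E w u) → (E u' w' ∨ E w' u') → side u = side u' →
      side w = side w' → side u ≠ side w → y u < y u' → y w ≤ y w') :
    HasLocalLayout E Set.univ := by
  classical
  have := Fintype.ofFinite W
  have hyR : ∀ u v, Relation.ReflTransGen E u v → y u ≤ y v := fun u v h => by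
    induction h with
    | refl => exact le_rfl
    | tail _ h ih => exact ih.trans (hy _ _ h).le
  have hyne : ∀ u v, Relation.ReflTransGen E u v → u ≠ v → y u < y v := fun u v h hne => by
    rcases h.cases_tail with h | ⟨w, hw, h⟩
    · exact absurd h.symm hne
    · exact (hyR _ _ hw).trans_lt (hy _ _ h)
  let H : W → Prop := fun h => ∃ t, E t h ∧ side t ≠ side h
  have hreach' : ∀ u v, side u = side v → y u ≤ y v → Relation.ReflTransGen E u v :=
    fun u v hs h => by
      rcases h.lt_or_eq with h | h
      · exact hreach u v hs h
      · rw [hinj u v hs h]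
  -- `H` marks the heads of edges between the sides. They form a chain even across sides: of two
  -- such edges running in opposite directions, consistency puts the head of one below the tail of
  -- the other.
  have hH : ∀ h h', H h → H h' → Relation.ReflTransGen E h h' ∨ Relation.ReflTransGen E h' h := by
    rintro h h' ⟨t, ht, hs⟩ ⟨t', ht', hs'⟩
    by_cases hhh : side h = side h'
    · exact (le_total (y h) (y h')).imp (hreach' _ _ hhh) (hreach' _ _ hhh.symm)
    · have hs1 : side t = side h' := Bool.eq_of_ne_of_ne hs (Ne.symm hhh)
      have hs2 : side h = side t' := Bool.eq_of_ne_of_ne hhh hs'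
      rcases lt_trichotomy (y t) (y h') with hlt | heq | hlt
      · left
        have := hcross t h h' t' (Or.inl ht) (Or.inr ht') hs1 hs2 hs hlt
        exact (hreach' _ _ hs2 this).tail ht'
      · right
        rw [← hinj _ _ hs1 heq]
        exact .single ht
      · right
        rcases le_or_gt (y h') (y t) with h1 | h1
        · exact (hreach' _ _ hs1.symm h1).tail ht
        · exact absurd h1 hlt.not_gt
  -- Ordering by `rank` extends reachability and puts each vertex after every marked head that it
  -- does not reach.
  let rank : W → ℕ := fun v =>
    (Finset.univ.filter fun h => H h ∧ ¬ Relation.ReflTransGen E v h).card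
  have hrank : ∀ u v, Relation.ReflTransGen E u v → rank u ≤ rank v := fun u v huv => by
    refine Finset.card_le_card fun h hh => ?_
    rw [Finset.mem_filter] at hh ⊢
    exact ⟨hh.1, hh.2.1, fun hv => hh.2.2 (huv.trans hv)⟩
  have hrank' : ∀ r l, H r → ¬ Relation.ReflTransGen E l r → rank r < rank l := by
    intro r l hr hlr
    refine Finset.card_lt_card ⟨fun h hh => ?_, fun hsub => ?_⟩
    · rw [Finset.mem_filter] at hh ⊢
      refine ⟨hh.1, hh.2.1, fun hl => hlr ?_⟩
      exact hl.trans ((hH r h hr hh.2.1).resolve_left hh.2.2)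
    · have := hsub (Finset.mem_filter.2 ⟨Finset.mem_univ r, hr, hlr⟩)
      exact (Finset.mem_filter.1 this).2.2 .refl
  obtain ⟨p, hp⟩ := exists_real_of_linearOrder
    fun v => toLex (rank v, toLex (y v, side v))
  have hpR : ∀ u v, Relation.ReflTransGen E u v → u ≠ v → p u < p v := by
    intro u v huv hne
    rw [hp, Prod.Lex.toLex_lt_toLex]
    rcases (hrank u v huv).lt_or_eq with h | h
    · exact Or.inl h
    · refine Or.inr ⟨h, ?_⟩
      rw [Prod.Lex.toLex_lt_toLex]
      exact Or.inl (hyne u v huv hne)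
  have hpside : ∀ u v, side u = side v → p u < p v → y u < y v := by
    intro u v hs huv
    by_contra hle
    have h := hreach' v u hs.symm (not_lt.1 hle)
    by_cases hvu : v = u
    · rw [hvu] at huv
      exact lt_irrefl _ huv
    · exact (hpR v u h hvu).not_gt huv
  -- `C u u'` is the only pattern in which two edges between the sides can cross: both tails send an
  -- edge to `w`, and the upper tail also sends one to a higher `w'`. Consistency determines `w`,
  -- and then `u'`, from `u`.
  let C : W → W → Prop := fun u u' => side u = side u' ∧ y u < y u' ∧
    ∃ w w', side w = side w' ∧ side u ≠ side w ∧ E u w ∧ E u' w ∧ E u' w' ∧ y w < y w'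
  obtain ⟨col, hcol⟩ : ∃ c : W → Bool, ∀ u v, C u v → c u ≠ c v := by
    refine exists_bool_coloring y C (fun u v h => h.2.1) ?_
    rintro u a b ⟨hua, hyua, w₁, w₁', hw₁, hs₁, huw₁, haw₁, haw₁', hlt₁⟩
      ⟨hub, hyub, w₂, w₂', hw₂, hs₂, huw₂, hbw₂, hbw₂', hlt₂⟩
    have hs : side w₁ = side w₂ := Bool.eq_of_ne_of_ne hs₁.symm hs₂.symm
    obtain rfl : w₁ = w₂ := by
      refine hinj _ _ hs (le_antisymm ?_ ?_)
      · exact hcross u w₁ b w₂ (Or.inl huw₁) (Or.inl hbw₂) hub hs hs₁ hyub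
      · exact hcross u w₂ a w₁ (Or.inl huw₂) (Or.inl haw₁) hua hs.symm hs₂ hyua
    refine hinj _ _ (hua.symm.trans hub) (le_antisymm ?_ ?_)
    · by_contra hlt
      have := hcross b w₂' a w₁ (Or.inl hbw₂') (Or.inl haw₁) (hub.symm.trans hua) hw₂.symm
        (by rw [← hub, ← hw₂]; exact hs₁) (not_le.1 hlt)
      linarith
    · by_contra hlt
      have := hcross a w₁' b w₁ (Or.inl haw₁') (Or.inl hbw₂) (hua.symm.trans hub) hw₁.symm
        (by rw [← hua, ← hw₁]; exact hs₁) (not_le.1 hlt)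
      linarith
  have hpar : ∀ a b c d, E a c → E b d → side a = side b → side c = side d → side a ≠ side c →
      p a < p b → p b < p c → p c < p d → C a b := by
    intro a b c d hac hbd hab hcd hne h1 h2 h3
    have hyab := hpside a b hab h1
    have hycd := hpside c d hcd h3
    -- Since `c` is a marked head placed after `b`, the vertex `b` must reach it. The edge in which
    -- such a path changes sides is then squeezed by consistency between `a c` and `b d`, and turns
    -- out to be `b c`.
    have hbc : Relation.ReflTransGen E b c := by
      by_contra hbc
      refine h2.not_gt ?_
      rw [hp, Prod.Lex.toLex_lt_toLex]
      exact Or.inl (hrank' c b ⟨a, hac, hne⟩ hbc)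
    obtain ⟨x, z, hxz, hbx, hzc, hsx, hsz⟩ := exists_edge_of_reflTransGen side hbc (hab ▸ hne)
    have hyx := hyR _ _ hbx
    obtain rfl : z = c := hinj _ _ hsz (le_antisymm (hyR _ _ hzc) <|
      hcross a c x z (Or.inl hac) (Or.inl hxz) (hab.trans hsx.symm) hsz.symm hne
        (hyab.trans_le hyx))
    obtain rfl : x = b := by
      refine hinj _ _ hsx (le_antisymm ?_ hyx)
      by_contra hlt
      have := hcross b d x z (Or.inl hbd) (Or.inl hxz) hsx.symm hcd.symm
        (by rw [← hab, ← hcd]; exact hne) (not_le.1 hlt)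
      linarith
    exact ⟨hab, hyab, z, d, hcd, hne, hac, hxz, hbd, hycd⟩
  -- Pages `0` and `1` are the inner pages of the two sides; an edge between the sides takes page
  -- `2` or `3` by the colour of its tail.
  let σ : W → W → Fin 4 := fun u v =>
    if side u = side v then (if side u then 0 else 1) else if col u then 2 else 3
  refine ⟨p, σ, ⟨?_, ?_, ?_⟩, ?_⟩
  · intro u _ v _ huv
    have h1 : ¬ toLex (rank u, toLex (y u, side u)) < toLex (rank v, toLex (y v, side v)) :=
      fun h => ((hp u v).2 h).ne huv
    have h2 : ¬ toLex (rank v, toLex (y v, side v)) < toLex (rank u, toLex (y u, side u)) :=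
      fun h => ((hp v u).2 h).ne' huv
    have h3 := le_antisymm (not_lt.1 h2) (not_lt.1 h1)
    simp only [EmbeddingLike.apply_eq_iff_eq, Prod.mk.injEq] at h3
    exact hinj u v h3.2.2 h3.2.1
  · intro u _ v _ huv
    exact hpR u v (.single huv) fun h => (hy u v huv).ne (congrArg y h)
  · intro a _ b _ c _ d _ hac hbd hσ h1 h2 h3
    simp only [σ] at hσ
    by_cases hsac : side a = side c <;> by_cases hsbd : side b = side d
    · have hcd : side c = side d := by
        simp only [hsac, hsbd, if_true] at hσ
        revert hσ
        cases side c <;> cases side d <;> simp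
      have hab : side a = side b := hsac.trans (hcd.trans hsbd.symm)
      have hbc : side b = side c := hab.symm.trans hsac
      exact hsame a b c d hac hbd hab hsac (hab.trans hsbd) (hpside a b hab h1)
        (hpside b c hbc h2) (hpside c d (hbc.symm.trans hsbd) h3)
    · simp only [hsac, hsbd, if_true, if_false] at hσ
      split_ifs at hσ <;> simp at hσ
    · simp only [hsac, hsbd, if_true, if_false] at hσ
      split_ifs at hσ <;> simp at hσ
    · simp only [hsac, hsbd, if_false] at hσ
      have hcol' : col a = col b := by
        revert hσ
        cases col a <;> cases col b <;> simp
      by_cases hab : side a = side b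
      · have hcd : side c = side d :=
          Bool.eq_of_ne_of_ne (Ne.symm hsac) (hab ▸ Ne.symm hsbd)
        exact hcol a b (hpar a b c d hac hbd hab hcd hsac h1 h2 h3) hcol'
      -- Edges in opposite directions never cross: `a` lies below `d`, so consistency puts `c` no
      -- higher than `b`.
      · have had : side a = side d :=
          Bool.eq_of_ne_of_ne hab (Ne.symm hsbd)
        have hcb : side c = side b :=
          Bool.eq_of_ne_of_ne (Ne.symm hsac) (Ne.symm hab)
        have h4 := hcross a c d b (Or.inl hac) (Or.inr hbd) had hcb hsac
          (hpside a d had (h1.trans (h2.trans h3)))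
        exact h4.not_gt (hpside b c hcb.symm h2)
  · intro w _
    refine ⟨if side w then 1 else 0, fun u _ v _ _ hw => ?_⟩
    simp only [σ]
    rcases hw with rfl | rfl
    · cases h1 : side u <;> cases h2 : side v <;> cases col u <;> simp
    · cases h1 : side u <;> cases h2 : side v <;> cases col u <;> simp

end TwoSided

/-! ### Monotone drawings -/

section Monotone

variable {W : Type*}

/-- A drawing in which the vertex `v` is the point `(x v, y v)` and the edge `uv` is the graph of
`f u v` over the interval `[y u, y v]` of the vertical axis, and edges meet only at common ends. -/
structure IsMonotoneDrawing (E : W → W → Prop) (x y : W → ℝ) (f : W → W → ℝ → ℝ) : Prop where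
  lt : ∀ u v, E u v → y u < y v
  continuous : ∀ u v, E u v → Continuous (f u v)
  start : ∀ u v, E u v → f u v (y u) = x u
  finish : ∀ u v, E u v → f u v (y v) = x v
  pos_injective : ∀ u v, x u = x v → y u = y v → u = v
  meet : ∀ u v u' v' t, E u v → E u' v' → y u ≤ t → t ≤ y v → y u' ≤ t → t ≤ y v' →
    f u v t = f u' v' t → (u = u' ∧ v = v') ∨ ∃ w, (w = u ∨ w = v) ∧ (w = u' ∨ w = v')

/-- No edge passes to the left of `w`. -/
def IsLeftmost (E : W → W → Prop) (x y : W → ℝ) (f : W → W → ℝ → ℝ) (w : W) : Prop :=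
  ∀ u v, E u v → y u ≤ y w → y w ≤ y v → x w ≤ f u v (y w)

/-- `P` describes a drawn directed path from `a` to `b`. -/
structure IsPathCurve (E : W → W → Prop) (x y : W → ℝ) (f : W → W → ℝ → ℝ) (a b : W)
    (P : ℝ → ℝ) : Prop where
  continuous : Continuous P
  start : P (y a) = x a
  finish : P (y b) = x b
  le : y a ≤ y b
  edge : ∀ t, y a ≤ t → t ≤ y b → a = b ∨ ∃ u v, E u v ∧ Relation.ReflTransGen E a u ∧
    Relation.ReflTransGen E v b ∧ y u ≤ t ∧ t ≤ y v ∧ P t = f u v t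

variable {E : W → W → Prop} {x y : W → ℝ} {f : W → W → ℝ → ℝ}

lemma exists_eq_of_le_of_le {g h : ℝ → ℝ} (hg : Continuous g) (hh : Continuous h) {t₁ t₂ : ℝ}
    (ht : t₁ ≤ t₂) (h₁ : g t₁ ≤ h t₁) (h₂ : h t₂ ≤ g t₂) : ∃ t, t₁ ≤ t ∧ t ≤ t₂ ∧ g t = h t := by
  have := intermediate_value_Icc ht (hg.sub hh).continuousOn
  obtain ⟨t, ht, h0⟩ := this (show (0 : ℝ) ∈ _ from ⟨by simpa using h₁, by simpa using h₂⟩)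
  exact ⟨t, ht.1, ht.2, sub_eq_zero.1 h0⟩

namespace IsMonotoneDrawing

lemma mirror (D : IsMonotoneDrawing E x y f) :
    IsMonotoneDrawing E (fun v => -x v) y (fun u v t => -f u v t) where
  lt := D.lt
  continuous u v h := (D.continuous u v h).neg
  start u v h := congrArg _ (D.start u v h)
  finish u v h := congrArg _ (D.finish u v h)
  pos_injective u v hx hy := D.pos_injective u v (neg_injective hx) hy
  meet u v u' v' t h h' h1 h2 h3 h4 he := D.meet u v u' v' t h h' h1 h2 h3 h4 (neg_injective he)

lemma le_of_reach (D : IsMonotoneDrawing E x y f) {u v : W} (h : Relation.ReflTransGen E u v) :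
    y u ≤ y v := by
  induction h with
  | refl => exact le_rfl
  | tail _ h ih => exact ih.trans (D.lt _ _ h).le

lemma no_crossing (D : IsMonotoneDrawing E x y f) {u v u' v' : W} (h : E u v) (h' : E u' v')
    (h₁ : u ≠ u') (h₂ : u ≠ v') (h₃ : v ≠ u') (h₄ : v ≠ v') {t₁ t₂ : ℝ} (ht : t₁ ≤ t₂)
    (hu : y u ≤ t₁) (hu' : y u' ≤ t₁) (hv : t₂ ≤ y v) (hv' : t₂ ≤ y v')
    (hf₁ : f u v t₁ ≤ f u' v' t₁) (hf₂ : f u' v' t₂ ≤ f u v t₂) : False := by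
  obtain ⟨t, ht1, ht2, he⟩ :=
    exists_eq_of_le_of_le (D.continuous _ _ h) (D.continuous _ _ h') ht hf₁ hf₂
  rcases D.meet u v u' v' t h h' (hu.trans ht1) (ht2.trans hv) (hu'.trans ht1) (ht2.trans hv') he
    with ⟨h, -⟩ | ⟨w, rfl | rfl, rfl | rfl⟩ <;> contradiction

/-- Curves meet only at common ends of edges, so two directed paths whose curves meet share a vertex
at which one can switch from one to the other. -/
lemma reach_of_meet (D : IsMonotoneDrawing E x y f) {a b u v u' v' : W} {t : ℝ} (h : E u v)
    (h' : E u' v') (ha : Relation.ReflTransGen E a u) (hb : Relation.ReflTransGen E v' b)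
    (hu : y u ≤ t) (hv : t ≤ y v) (hu' : y u' ≤ t) (hv' : t ≤ y v')
    (hf : f u v t = f u' v' t) : Relation.ReflTransGen E a b := by
  rcases D.meet u v u' v' t h h' hu hv hu' hv' hf with ⟨rfl, rfl⟩ | ⟨w, hw, hw'⟩
  · exact (ha.tail h).trans hb
  · have h1 : Relation.ReflTransGen E a w := by
      rcases hw with rfl | rfl
      · exact ha
      · exact ha.tail h
    have h2 : Relation.ReflTransGen E w b := by
      rcases hw' with rfl | rfl
      · exact .head h' hb
      · exact hb
    exact h1.trans h2

lemma isPathCurve_edge (D : IsMonotoneDrawing E x y f) {u v : W} (h : E u v) :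
    IsPathCurve E x y f u v (f u v) where
  continuous := D.continuous u v h
  start := D.start u v h
  finish := D.finish u v h
  le := (D.lt u v h).le
  edge _ h1 h2 := Or.inr ⟨u, v, h, .refl, .refl, h1, h2, rfl⟩

end IsMonotoneDrawing

lemma IsPathCurve.reach {a b : W} {P : ℝ → ℝ} (hP : IsPathCurve E x y f a b P) :
    Relation.ReflTransGen E a b := by
  rcases hP.edge (y a) le_rfl hP.le with rfl | ⟨u, v, h, ha, hb, -⟩
  · exact .refl
  · exact (ha.tail h).trans hb

lemma IsPathCurve.trans {a b c : W} {P Q : ℝ → ℝ} (hP : IsPathCurve E x y f a b P)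
    (hQ : IsPathCurve E x y f b c Q) :
    IsPathCurve E x y f a c (fun t => if t ≤ y b then P t else Q t) where
  continuous := by
    refine Continuous.if_le hP.continuous hQ.continuous continuous_id continuous_const ?_
    rintro t rfl
    exact hP.finish.trans hQ.start.symm
  start := by simp only [hP.le, if_true, hP.start]
  finish := by
    by_cases h : y c ≤ y b
    · have := le_antisymm h hQ.le
      simp only [h, if_true]
      rw [this, hP.finish, ← hQ.start, ← this, hQ.finish]
    · simp only [h, if_false, hQ.finish]
  le := hP.le.trans hQ.le
  edge t h1 h2 := by
    by_cases h : t ≤ y b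
    · simp only [h, if_true]
      -- The first path may be a single vertex; then `t` is its height and an edge of the second
      -- path takes over.
      rcases hP.edge t h1 h with rfl | ⟨u, v, huv, hu, hv, h3⟩
      · obtain rfl := le_antisymm h h1
        rcases hQ.edge _ le_rfl hQ.le with hac | ⟨u, v, huv, hu, hv, h3, h4, h5⟩
        · exact Or.inl hac
        · exact Or.inr ⟨u, v, huv, hu, hv, h3, h4, by rw [hP.start, ← h5, hQ.start]⟩
      · exact Or.inr ⟨u, v, huv, hu, hv.trans hQ.reach, h3⟩
    · simp only [h, if_false]
      rcases hQ.edge t (not_le.1 h).le h2 with rfl | ⟨u, v, huv, hu, hv, h3⟩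
      · exact absurd h2 h
      · exact Or.inr ⟨u, v, huv, hP.reach.trans hu, hv, h3⟩

namespace IsMonotoneDrawing

lemma exists_isPathCurve (D : IsMonotoneDrawing E x y f) {a b : W}
    (h : Relation.ReflTransGen E a b) : ∃ P, IsPathCurve E x y f a b P := by
  induction h with
  | refl => exact ⟨fun _ => x a, continuous_const, rfl, rfl, le_rfl, fun _ _ _ => Or.inl rfl⟩
  | tail _ h ih =>
    obtain ⟨P, hP⟩ := ih
    exact ⟨_, hP.trans (D.isPathCurve_edge h)⟩

lemma exists_isPathCurve_through (D : IsMonotoneDrawing E x y f) {a b u v : W} (h : E u v)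
    (ha : Relation.ReflTransGen E a u) (hb : Relation.ReflTransGen E v b) :
    ∃ P, IsPathCurve E x y f a b P ∧ ∀ t, y u ≤ t → t ≤ y v → P t = f u v t := by
  obtain ⟨P, hP⟩ := D.exists_isPathCurve ha
  obtain ⟨Q, hQ⟩ := D.exists_isPathCurve hb
  refine ⟨_, (hP.trans (D.isPathCurve_edge h)).trans hQ, fun t h1 h2 => ?_⟩
  simp only [h2, if_true]
  split_ifs with h3
  · obtain rfl := le_antisymm h1 h3
    rw [hP.finish, D.start u v h]
  · rfl

variable {s t : W}

/-- `IsLeftmost` compares a vertex with edges only, so comparing two vertices requires an edge curve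
through one of them. -/
lemma exists_edge_at (D : IsMonotoneDrawing E x y f) (hs : ∀ v, Relation.ReflTransGen E s v)
    (ht : ∀ v, Relation.ReflTransGen E v t) {u v : W} (huv : u ≠ v) :
    ∃ a b, E a b ∧ y a ≤ y v ∧ y v ≤ y b ∧ f a b (y v) = x v := by
  rcases (hs v).cases_tail with h | ⟨a, -, h⟩
  · rcases (ht v).cases_head with h' | ⟨b, h, -⟩
    · subst h h'
      rcases (hs u).cases_head with h | ⟨b, h, -⟩
      · exact absurd h.symm huv
      · exact ⟨_, b, h, le_rfl, (D.lt _ _ h).le, D.start _ _ h⟩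
    · exact ⟨v, b, h, le_rfl, (D.lt _ _ h).le, D.start _ _ h⟩
  · exact ⟨a, v, h, (D.lt _ _ h).le, le_rfl, D.finish _ _ h⟩

lemma eq_of_isLeftmost (D : IsMonotoneDrawing E x y f) (hs : ∀ v, Relation.ReflTransGen E s v)
    (ht : ∀ v, Relation.ReflTransGen E v t) {u v : W} (hu : IsLeftmost E x y f u)
    (hv : IsLeftmost E x y f v) (h : y u = y v) : u = v := by
  by_contra huv
  obtain ⟨a, b, hab, h1, h2, h3⟩ := D.exists_edge_at hs ht huv
  obtain ⟨c, d, hcd, h4, h5, h6⟩ := D.exists_edge_at hs ht (Ne.symm huv)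
  have h7 := hu a b hab (h ▸ h1) (h ▸ h2)
  have h8 := hv c d hcd (h ▸ h4) (h ▸ h5)
  rw [h, h3] at h7
  rw [← h, h6] at h8
  exact huv (D.pos_injective u v (le_antisymm h7 h8) h)

/-- A path from `u` up to `t` starts weakly left of a path from `s` up to `v`, because `u` is
leftmost; at the height of `v` the order is reversed, because `v` is leftmost. The paths meet in
between. -/
lemma reach_of_isLeftmost (D : IsMonotoneDrawing E x y f)
    (hs : ∀ v, Relation.ReflTransGen E s v) (ht : ∀ v, Relation.ReflTransGen E v t) {u v : W}
    (hu : IsLeftmost E x y f u) (hv : IsLeftmost E x y f v) (h : y u < y v) :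
    Relation.ReflTransGen E u v := by
  obtain ⟨P, hP⟩ := D.exists_isPathCurve (ht u)
  obtain ⟨Q, hQ⟩ := D.exists_isPathCurve (hs v)
  have hyt := D.le_of_reach (ht v)
  have hys := D.le_of_reach (hs u)
  have hPe : ∀ r, y u ≤ r → r ≤ y t → _ := fun r h1 h2 =>
    (hP.edge r h1 h2).resolve_left fun he => (h.trans_le hyt).ne (congrArg y he)
  have hQe : ∀ r, y s ≤ r → r ≤ y v → _ := fun r h1 h2 =>
    (hQ.edge r h1 h2).resolve_left fun he => (hys.trans_lt h).ne (congrArg y he)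
  have h₁ : P (y u) ≤ Q (y u) := by
    obtain ⟨a, b, hab, -, -, h1, h2, h3⟩ := hQe (y u) hys h.le
    rw [h3, hP.start]
    exact hu a b hab h1 h2
  have h₂ : Q (y v) ≤ P (y v) := by
    obtain ⟨a, b, hab, -, -, h1, h2, h3⟩ := hPe (y v) h.le hyt
    rw [h3, hQ.finish]
    exact hv a b hab h1 h2
  obtain ⟨r, hr1, hr2, he⟩ := exists_eq_of_le_of_le hP.continuous hQ.continuous h.le h₁ h₂
  obtain ⟨a, b, hab, ha, -, h1, h2, h3⟩ := hPe r hr1 (hr2.trans hyt)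
  obtain ⟨c, d, hcd, -, hd, h4, h5, h6⟩ := hQe r (hys.trans hr1) hr2
  exact D.reach_of_meet hab hcd ha hd h1 h2 h4 h5 (h3 ▸ h6 ▸ he)

/-- The edge `b d` starts left of `a c` at the height of `b`, and `a c` ends left of `b d` at the
height of `c`, so they would cross. -/
lemma not_interleave_of_isLeftmost (D : IsMonotoneDrawing E x y f) {a b c d : W} (hac : E a c)
    (hbd : E b d) (hb : IsLeftmost E x y f b) (hc : IsLeftmost E x y f c) (h₁ : y a < y b)
    (h₂ : y b < y c) (h₃ : y c < y d) : False := by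
  refine D.no_crossing hbd hac ?_ ?_ ?_ ?_ h₂.le le_rfl h₁.le h₃.le le_rfl ?_ ?_
  · rintro rfl; exact lt_irrefl _ h₁
  · rintro rfl; exact lt_irrefl _ h₂
  · rintro rfl; linarith
  · rintro rfl; exact lt_irrefl _ h₃
  · rw [D.start b d hbd]
    exact hb a c hac h₁.le h₂.le
  · rw [D.finish a c hac]
    exact hc b d hbd h₂.le h₃.le

/-- If the order were reversed, the two edges would swap sides between the ends of their common
height interval. The hypotheses `hne` and `hne'` exclude common ends, which would be possible since
a vertex may be both leftmost and rightmost. -/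
lemma le_of_opposite (D : IsMonotoneDrawing E x y f) {u u' w w' : W}
    (hu : IsLeftmost E x y f u) (hu' : IsLeftmost E x y f u')
    (hw : IsLeftmost E (fun v => -x v) y (fun u v t => -f u v t) w)
    (hw' : IsLeftmost E (fun v => -x v) y (fun u v t => -f u v t) w')
    (hne : u ≠ w') (hne' : w ≠ u') (h : E u w ∨ E w u) (h' : E u' w' ∨ E w' u')
    (hlt : y u < y u') : y w ≤ y w' := by
  by_contra hlt'
  rw [not_le] at hlt'
  have h1 : u ≠ u' := fun h => hlt.ne (congrArg y h)
  have h2 : w ≠ w' := fun h => hlt'.ne' (congrArg y h)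
  simp only [IsLeftmost, neg_le_neg_iff] at hw hw'
  rcases h with h | h <;> rcases h' with h' | h'
  · have h3 := D.lt _ _ h
    have h4 := D.lt _ _ h'
    refine D.no_crossing h' h h1.symm hne'.symm hne.symm h2.symm h4.le le_rfl hlt.le le_rfl
      hlt'.le ?_ ?_
    · rw [D.start _ _ h']
      exact hu' u w h hlt.le (h4.trans hlt').le
    · rw [D.finish _ _ h']
      exact hw' u w h (hlt.trans h4).le hlt'.le
  · have h3 := D.lt _ _ h
    have h4 := D.lt _ _ h'
    refine D.no_crossing h h' hne h1 h2 hne' (t₁ := max (y u) (y w')) (t₂ := min (y w) (y u'))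
      (max_le (le_min h3.le hlt.le) (le_min hlt'.le h4.le)) (le_max_left _ _) (le_max_right _ _)
      (min_le_left _ _) (min_le_right _ _) ?_ ?_
    · rcases le_total (y u) (y w') with h5 | h5
      · rw [max_eq_right h5, D.start _ _ h']
        exact hw' u w h h5 hlt'.le
      · rw [max_eq_left h5, D.start _ _ h]
        exact hu w' u' h' h5 hlt.le
    · rcases le_total (y w) (y u') with h5 | h5
      · rw [min_eq_left h5, D.finish _ _ h]
        exact hw w' u' h' hlt'.le h5
      · rw [min_eq_right h5, D.finish _ _ h']
        exact hu' u w h hlt.le h5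
  · have h3 := D.lt _ _ h
    have h4 := D.lt _ _ h'
    linarith
  · have h3 := D.lt _ _ h
    have h4 := D.lt _ _ h'
    refine D.no_crossing h' h h2.symm hne.symm hne'.symm h1.symm h3.le hlt'.le le_rfl hlt.le
      le_rfl ?_ ?_
    · rw [D.start _ _ h]
      exact hw w' u' h' hlt'.le (h3.trans hlt).le
    · rw [D.finish _ _ h]
      exact hu w' u' h' (hlt'.trans h3).le hlt.le

/-- If no vertex is enclosed by two drawn directed paths, then each vertex is leftmost or
rightmost. -/
lemma isLeftmost_or_mirror (D : IsMonotoneDrawing E x y f)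
    (hs : ∀ v, Relation.ReflTransGen E s v) (ht : ∀ v, Relation.ReflTransGen E v t)
    (henc : ∀ (w : W) (a b : ℝ) (P Q : ℝ → ℝ), Continuous P → Continuous Q → a ≤ y w → y w ≤ b →
      P a = Q a → P b = Q b →
      (∀ r, a ≤ r → r ≤ b → ∃ u v, E u v ∧ y u ≤ r ∧ r ≤ y v ∧ P r = f u v r) →
      (∀ r, a ≤ r → r ≤ b → ∃ u v, E u v ∧ y u ≤ r ∧ r ≤ y v ∧ Q r = f u v r) →
      P (y w) < x w → x w < Q (y w) → False) (w : W) :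
    IsLeftmost E x y f w ∨ IsLeftmost E (fun v => -x v) y (fun u v t => -f u v t) w := by
  by_contra hno
  simp only [IsLeftmost, not_or, not_forall, not_le, neg_lt_neg_iff] at hno
  obtain ⟨⟨u, v, huv, h1, h2, h3⟩, u', v', huv', h1', h2', h3'⟩ := hno
  obtain ⟨P, hP, hPe⟩ := D.exists_isPathCurve_through huv (hs u) (ht v)
  obtain ⟨Q, hQ, hQe⟩ := D.exists_isPathCurve_through huv' (hs u') (ht v')
  have hst : s ≠ t := by
    rintro rfl
    have := D.le_of_reach (hs u)
    have := D.le_of_reach (ht v)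
    have := D.lt u v huv
    linarith
  refine henc w (y s) (y t) P Q hP.continuous hQ.continuous (D.le_of_reach (hs w))
    (D.le_of_reach (ht w)) (hP.start.trans hQ.start.symm) (hP.finish.trans hQ.finish.symm) ?_ ?_
    ?_ ?_
  · intro r hr hr'
    obtain ⟨u, v, h, -, -, h'⟩ := (hP.edge r hr hr').resolve_left hst
    exact ⟨u, v, h, h'⟩
  · intro r hr hr'
    obtain ⟨u, v, h, -, -, h'⟩ := (hQ.edge r hr hr').resolve_left hst
    exact ⟨u, v, h, h'⟩
  · rwa [hPe _ h1 h2]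
  · rwa [hQe _ h1' h2']

theorem hasLocalLayout [Finite W] (D : IsMonotoneDrawing E x y f)
    (hs : ∀ v, Relation.ReflTransGen E s v) (ht : ∀ v, Relation.ReflTransGen E v t)
    (hside : ∀ w, IsLeftmost E x y f w ∨
      IsLeftmost E (fun v => -x v) y (fun u v t => -f u v t) w) :
    HasLocalLayout E Set.univ := by
  classical
  -- A vertex that is both leftmost and rightmost is counted on the left; the right side is treated
  -- by `mirror`.
  let side : W → Bool := fun w => decide (IsLeftmost E x y f w)
  have hl : ∀ w, side w = true → IsLeftmost E x y f w := fun w h => of_decide_eq_true h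
  have hr : ∀ w, side w = false → IsLeftmost E (fun v => -x v) y (fun u v t => -f u v t) w :=
    fun w h => (hside w).resolve_left (of_decide_eq_false h)
  have hll : ∀ w, side w = true →
      IsLeftmost E (fun v => - -x v) y (fun u v t => - -f u v t) w := fun w h => by
    simpa only [neg_neg] using hl w h
  refine hasLocalLayout_of_two_sided side y D.lt ?_ ?_ ?_ ?_
  · intro u v h hy
    cases hu : side u
    · exact D.mirror.eq_of_isLeftmost hs ht (hr u hu) (hr v (h ▸ hu)) hy
    · exact D.eq_of_isLeftmost hs ht (hl u hu) (hl v (h ▸ hu)) hy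
  · intro u v h hy
    cases hu : side u
    · exact D.mirror.reach_of_isLeftmost hs ht (hr u hu) (hr v (h ▸ hu)) hy
    · exact D.reach_of_isLeftmost hs ht (hl u hu) (hl v (h ▸ hu)) hy
  · intro a b c d hac hbd hab hac' had h1 h2 h3
    cases ha : side a
    · exact D.mirror.not_interleave_of_isLeftmost hac hbd (hr b (hab ▸ ha)) (hr c (hac' ▸ ha))
        h1 h2 h3
    · exact D.not_interleave_of_isLeftmost hac hbd (hl b (hab ▸ ha)) (hl c (hac' ▸ ha)) h1 h2 h3
  · intro u w u' w' h h' hu hw hne hlt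
    have h1 : u ≠ w' := fun h => hne (by rw [hw, h])
    have h2 : w ≠ u' := fun h => hne (by rw [hu, h])
    cases hsu : side u
    · have hsw : side w = true := by
        rw [hsu] at hne
        exact Bool.eq_true_of_not_eq_false (Ne.symm hne)
      exact D.mirror.le_of_opposite (hr u hsu) (hr u' (hu ▸ hsu)) (hll w hsw) (hll w' (hw ▸ hsw))
        h1 h2 h h' hlt
    · have hsw : side w = false := by
        rw [hsu] at hne
        exact Bool.eq_false_of_not_eq_true (Ne.symm hne)
      exact D.le_of_opposite (hl u hsu) (hl u' (hu ▸ hsu)) (hr w hsw) (hr w' (hw ▸ hsw))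
        h1 h2 h h' hlt

end IsMonotoneDrawing

end Monotone

/-! ### From upward outerplanar drawings to monotone drawings -/

/-- A point strictly between two curves that are drawn in `K` and have common end points is not on
the boundary of an unbounded component of the complement of `K`. -/
lemma notMem_closure_of_enclosed {K : Set (ℝ × ℝ)} {P Q : ℝ → ℝ} (hP : Continuous P)
    (hQ : Continuous Q) {a b : ℝ} (ha : P a = Q a) (hb : P b = Q b)
    (hPK : ∀ r, a ≤ r → r ≤ b → (P r, r) ∈ K) (hQK : ∀ r, a ≤ r → r ≤ b → (Q r, r) ∈ K)
    {z : ℝ × ℝ} (hza : a ≤ z.2) (hzb : z.2 ≤ b) (hPz : P z.2 < z.1) (hzQ : z.1 < Q z.2) :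
    z ∉ closure {p | p ∈ Kᶜ ∧ ¬ Bornology.IsBounded (connectedComponentIn Kᶜ p)} := by
  intro hz
  let U : Set (ℝ × ℝ) := {z | (a < z.2 ∧ z.2 < b) ∧ P z.2 < z.1 ∧ z.1 < Q z.2}
  let D : Set (ℝ × ℝ) := {z | (a ≤ z.2 ∧ z.2 ≤ b) ∧ P z.2 ≤ z.1 ∧ z.1 ≤ Q z.2}
  have hU : IsOpen U :=
    ((isOpen_lt continuous_const continuous_snd).inter
      (isOpen_lt continuous_snd continuous_const)).inter
    ((isOpen_lt (hP.comp continuous_snd) continuous_fst).inter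
      (isOpen_lt continuous_fst (hQ.comp continuous_snd)))
  have hD : IsClosed D :=
    ((isClosed_le continuous_const continuous_snd).inter
      (isClosed_le continuous_snd continuous_const)).inter
    ((isClosed_le (hP.comp continuous_snd) continuous_fst).inter
      (isClosed_le continuous_fst (hQ.comp continuous_snd)))
  have hUD : U ⊆ D := fun z hz => ⟨⟨hz.1.1.le, hz.1.2.le⟩, hz.2.1.le, hz.2.2.le⟩
  -- The boundary of the region between the curves is drawn in `K`; at heights `a` and `b` the
  -- region shrinks to a point of `K`. A component of `Kᶜ` meeting `U` therefore stays in `U`, which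
  -- is bounded.
  have hDK : ∀ z ∈ D, z ∉ K → z ∈ U := by
    rintro ⟨z₁, z₂⟩ ⟨⟨h1, h2⟩, h3, h4⟩ hzK
    simp only at h1 h2 h3 h4
    have h5 : P z₂ ≠ z₁ := fun h => hzK (h ▸ hPK z₂ h1 h2)
    have h6 : z₁ ≠ Q z₂ := fun h => hzK (h ▸ hQK z₂ h1 h2)
    refine ⟨⟨lt_of_le_of_ne h1 ?_, lt_of_le_of_ne h2 ?_⟩, lt_of_le_of_ne h3 h5,
      lt_of_le_of_ne h4 h6⟩
    · rintro rfl
      exact h5 (le_antisymm h3 (ha ▸ h4))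
    · rintro rfl
      exact h5 (le_antisymm h3 (hb ▸ h4))
  have hDb : Bornology.IsBounded D := by
    obtain ⟨m, hm⟩ := (isCompact_Icc (a := a) (b := b)).bddBelow_image hP.continuousOn
    obtain ⟨M, hM⟩ := (isCompact_Icc (a := a) (b := b)).bddAbove_image hQ.continuousOn
    refine ((Metric.isBounded_Icc m M).prod (Metric.isBounded_Icc a b)).subset ?_
    intro z hz
    exact ⟨⟨(hm ⟨z.2, hz.1, rfl⟩).trans hz.2.1, hz.2.2.trans (hM ⟨z.2, hz.1, rfl⟩)⟩, hz.1⟩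
  have hzU : z ∈ U := by
    refine ⟨⟨lt_of_le_of_ne hza ?_, lt_of_le_of_ne hzb ?_⟩, hPz, hzQ⟩
    · rintro rfl
      exact (hPz.trans hzQ).ne ha
    · intro h
      rw [← h] at hb
      exact (hPz.trans hzQ).ne hb
  obtain ⟨p, hpU, hpK, hpb⟩ := mem_closure_iff.1 hz U hU hzU
  refine hpb (hDb.subset (Set.Subset.trans ?_ hUD))
  refine IsPreconnected.subset_left_of_subset_union hU hD.isOpen_compl ?_ ?_ ?_
    isPreconnected_connectedComponentIn
  · exact Set.disjoint_left.2 fun z hz hz' => hz' (hUD hz)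
  · intro z hz
    by_cases hzD : z ∈ D
    · exact Or.inl (hDK z hzD (connectedComponentIn_subset _ _ hz))
    · exact Or.inr hzD
  · exact ⟨p, mem_connectedComponentIn hpK, hpU⟩

/-- An upward arc contains the graph of a continuous function of the height. -/
lemma IsUpwardArc.exists_graph {p q : ℝ × ℝ} {A : Set (ℝ × ℝ)} (h : IsUpwardArc p q A) :
    p.2 < q.2 ∧ ∃ f : ℝ → ℝ, Continuous f ∧ f p.2 = p.1 ∧ f q.2 = q.1 ∧
      ∀ t, p.2 ≤ t → t ≤ q.2 → (f t, t) ∈ A := by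
  obtain ⟨γ, hγ, hmono, rfl, rfl, rfl⟩ := h
  have hlt : (γ 0).2 < (γ 1).2 := hmono zero_lt_one
  refine ⟨hlt, ?_⟩
  let g : unitInterval → Set.Icc (γ 0).2 (γ 1).2 := fun t =>
    ⟨(γ t).2, hmono.monotone unitInterval.nonneg', hmono.monotone unitInterval.le_one'⟩
  have hg : StrictMono g := fun s t h => hmono h
  have hsurj : Function.Surjective g := by
    rintro ⟨r, hr⟩
    have := intermediate_value_univ (0 : unitInterval) 1 (continuous_snd.comp hγ)
    obtain ⟨t, ht⟩ := this hr
    exact ⟨t, Subtype.ext ht⟩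
  -- An order isomorphism is a homeomorphism for the order topologies, so the arc can be
  -- reparametrised continuously by height.
  let e := hg.orderIsoOfSurjective g hsurj
  have he : ∀ t, (γ (e.symm t)).2 = t := fun t => congrArg Subtype.val (e.apply_symm_apply t)
  refine ⟨Set.IccExtend hlt.le fun t => (γ (e.symm t)).1, ?_, ?_, ?_, ?_⟩
  · exact (continuous_fst.comp (hγ.comp e.symm.continuous)).Icc_extend'
  · rw [Set.IccExtend_left]
    have : e.symm ⟨(γ 0).2, Set.left_mem_Icc.2 hlt.le⟩ = 0 := by
      rw [OrderIso.symm_apply_eq]; rfl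
    rw [this]
  · rw [Set.IccExtend_right]
    have : e.symm ⟨(γ 1).2, Set.right_mem_Icc.2 hlt.le⟩ = 1 := by
      rw [OrderIso.symm_apply_eq]; rfl
    rw [this]
  · intro t h1 h2
    rw [Set.IccExtend_of_mem _ _ ⟨h1, h2⟩]
    exact ⟨e.symm ⟨t, h1, h2⟩, Prod.ext rfl (he ⟨t, h1, h2⟩)⟩

namespace Digraph

variable {V : Type*}

lemma toSimpleGraphInclusive_adj_of_adj {G : Digraph V} (hirr : ∀ v, ¬ G.Adj v v) {u v : V}
    (h : G.Adj u v) : G.toSimpleGraphInclusive.Adj u v := by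
  refine (SimpleGraph.fromRel_adj _ _ _).2 ⟨?_, Or.inl h⟩
  rintro rfl
  exact hirr _ h

/-- In a finite digraph with a height function, a unique source reaches every vertex. -/
lemma reach_of_unique_source {W : Type*} [Finite W] {E : W → W → Prop} (y : W → ℝ)
    (hy : ∀ u v, E u v → y u < y v) {s : W} (hs : ∀ v, (∀ u, ¬ E u v) → v = s) (v : W) :
    Relation.ReflTransGen E s v := by
  obtain ⟨m, hm, hmin⟩ := Set.exists_min_image {u | Relation.ReflTransGen E u v} y
    (Set.toFinite _) ⟨v, .refl⟩
  have : m = s := hs m fun u hu => (hmin u (.head hu hm)).not_gt (hy u m hu)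
  exact this ▸ hm

lemma IsUpwardOuterplanar.irrefl {G : Digraph V} (hG : G.IsUpwardOuterplanar) (v : V) :
    ¬ G.Adj v v := by
  obtain ⟨D, -, hup⟩ := hG
  exact fun h => lt_irrefl _ (hup v v h).exists_graph.1

/-- Each part of an upward outerplanar graph that induces an `st`-graph has a local layout. -/
theorem IsUpwardOuterplanar.hasLocalLayout_induceOn [Finite V] {G : Digraph V}
    (hG : G.IsUpwardOuterplanar) (B : Set V) (hB : (G.induceOn B).IsSTDAG) :
    HasLocalLayout (G.induceOn B).Adj Set.univ := by
  classical
  have hirr := hG.irrefl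
  obtain ⟨D, hout, hup⟩ := hG
  have hgraph := fun u v h => (hup u v h).exists_graph
  choose hlt f hf hstart hfinish hmem using hgraph
  let x : B → ℝ := fun v => (D.pos v).1
  let y : B → ℝ := fun v => (D.pos v).2
  let F : B → B → ℝ → ℝ := fun u v => if h : G.Adj u v then f u v h else 0
  have hF : ∀ u v : B, ∀ h : G.Adj u v, F u v = f u v h := fun u v h => dif_pos h
  have hedge : ∀ u v : B, G.Adj u v → s((u : V), (v : V)) ∈ G.toSimpleGraphInclusive.edgeSet :=
    fun u v h => toSimpleGraphInclusive_adj_of_adj hirr h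
  have hD : IsMonotoneDrawing (G.induceOn B).Adj x y F :=
    { lt := fun u v h => hlt u v h
      continuous := fun u v h => hF u v h ▸ hf u v h
      start := fun u v h => hF u v h ▸ hstart u v h
      finish := fun u v h => hF u v h ▸ hfinish u v h
      pos_injective := fun u v hx hy => Subtype.ext (D.pos_injective (Prod.ext hx hy))
      meet := by
        intro u v u' v' t h h' h1 h2 h3 h4 he
        rw [hF u v h, hF u' v' h'] at he
        have hm := hmem u v h t h1 h2
        have hm' := hmem u' v' h' t h3 h4
        rw [← he] at hm'
        by_cases hee : s((u : V), (v : V)) = s((u' : V), (v' : V))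
        · rcases Sym2.eq_iff.1 hee with ⟨h5, h6⟩ | ⟨h5, h6⟩
          · exact Or.inl ⟨Subtype.ext h5, Subtype.ext h6⟩
          · obtain rfl : u = v' := Subtype.ext h5
            obtain rfl : v = u' := Subtype.ext h6
            exact absurd (hlt _ _ h) (hlt _ _ h').not_gt
        · obtain ⟨w, ⟨hw, hw'⟩, -⟩ := D.arc_inter_arc _ (hedge u v h) _ (hedge u' v' h') hee
            ⟨hm, hm'⟩
          rw [Sym2.mem_iff] at hw hw'
          have hwB : w ∈ B := by
            rcases hw with rfl | rfl <;> exact Subtype.property _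
          exact Or.inr ⟨⟨w, hwB⟩, hw.imp Subtype.ext Subtype.ext, hw'.imp Subtype.ext Subtype.ext⟩ }
  have hsupp : ∀ (u v : B) (t : ℝ), G.Adj u v → y u ≤ t → t ≤ y v → (F u v t, t) ∈ D.support := by
    intro u v t h h1 h2
    rw [hF u v h]
    exact Or.inr (Set.mem_biUnion (hedge u v h) (hmem u v h t h1 h2))
  obtain ⟨-, ⟨s, -, hs⟩, ⟨t, -, ht⟩⟩ := hB
  have hs' : ∀ v, Relation.ReflTransGen (G.induceOn B).Adj s v :=
    reach_of_unique_source y hD.lt hs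
  have ht' : ∀ v, Relation.ReflTransGen (G.induceOn B).Adj v t := fun v => by
    have := reach_of_unique_source (E := Function.swap (G.induceOn B).Adj) (fun v => -y v)
      (fun u v h => neg_lt_neg (hD.lt v u h)) ht v
    exact Relation.reflTransGen_swap.1 this
  refine hD.hasLocalLayout hs' ht' (hD.isLeftmost_or_mirror hs' ht' ?_)
  intro w a b P Q hP hQ haw hwb ha hb hPe hQe hPw hwQ
  -- The enclosing paths lie in `B`, hence in the drawing of all of `G`, whose outer face has every
  -- vertex on its boundary.
  refine notMem_closure_of_enclosed (K := D.support) hP hQ ha hb ?_ ?_ haw hwb hPw hwQ (hout w)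
  · intro r h1 h2
    obtain ⟨u, v, h, h3, h4, h5⟩ := hPe r h1 h2
    exact h5 ▸ hsupp u v r h h3 h4
  · intro r h1 h2
    obtain ⟨u, v, h, h3, h4, h5⟩ := hQe r h1 h2
    exact h5 ▸ hsupp u v r h h3 h4

lemma hasLocalLayout_of_induceOn {G : Digraph V} {B : Set V}
    (h : HasLocalLayout (G.induceOn B).Adj Set.univ) : HasLocalLayout G.Adj B := by
  classical
  obtain ⟨p, σ, h, hw⟩ := h
  let p' : V → ℝ := fun v => if hv : v ∈ B then p ⟨v, hv⟩ else 0
  let σ' : V → V → Fin 4 := fun u v =>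
    if huv : u ∈ B ∧ v ∈ B then σ ⟨u, huv.1⟩ ⟨v, huv.2⟩ else 0
  have hp : ∀ v (hv : v ∈ B), p' v = p ⟨v, hv⟩ := fun v hv => dif_pos hv
  have hσ : ∀ u v (hu : u ∈ B) (hv : v ∈ B), σ' u v = σ ⟨u, hu⟩ ⟨v, hv⟩ :=
    fun u v hu hv => dif_pos ⟨hu, hv⟩
  refine ⟨p', σ', ⟨?_, ?_, ?_⟩, ?_⟩
  · intro u hu v hv huv
    rw [hp u hu, hp v hv] at huv
    exact congrArg Subtype.val (h.injOn trivial trivial huv)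
  · intro u hu v hv huv
    rw [hp u hu, hp v hv]
    exact h.lt _ trivial _ trivial huv
  · intro a ha b hb c hc d hd hac hbd hs h1 h2 h3
    rw [hσ a c ha hc, hσ b d hb hd] at hs
    rw [hp a ha, hp b hb] at h1
    rw [hp b hb, hp c hc] at h2
    rw [hp c hc, hp d hd] at h3
    exact h.not_cross ⟨a, ha⟩ trivial ⟨b, hb⟩ trivial ⟨c, hc⟩ trivial ⟨d, hd⟩ trivial hac hbd hs
      h1 h2 h3
  · intro w hwB
    obtain ⟨i, hi⟩ := hw ⟨w, hwB⟩ trivial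
    refine ⟨i, fun u hu v hv huv huw => ?_⟩
    rw [hσ u v hu hv]
    exact hi _ trivial _ trivial huv (huw.imp Subtype.ext Subtype.ext)

end Digraph

/-! ### From real positions to book embeddings, and the theorem. -/

lemma IsUpwardLayout.nonempty_upwardBookEmbedding {V : Type*} [Fintype V] {G : Digraph V} {k : ℕ}
    {p : V → ℝ} {σ : V → V → Fin k} (h : IsUpwardLayout G.Adj Set.univ p σ) :
    Nonempty (G.UpwardBookEmbedding k) := by
  let _ : LinearOrder V := LinearOrder.lift' p (Set.injOn_univ.1 h.injOn)
  have hlt : ∀ u v : V, u < v ↔ p u < p v := fun _ _ => Iff.rfl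
  let π : V ≃o Fin (Fintype.card V) := (Fintype.orderIsoFinOfCardEq V rfl).symm
  refine ⟨⟨π.toEquiv, fun e => σ e.1.1 e.1.2, fun u v huv => ?_, ?_⟩⟩
  · exact π.lt_iff_lt.2 (h.lt u trivial v trivial huv)
  · rintro e f hσ ⟨h1, h2, h3⟩
    exact h.not_cross _ trivial _ trivial _ trivial _ trivial e.2 f.2 hσ
      ((hlt _ _).1 (π.lt_iff_lt.1 h1)) ((hlt _ _).1 (π.lt_iff_lt.1 h2))
      ((hlt _ _).1 (π.lt_iff_lt.1 h3))

theorem theorem2 {V : Type*} [Fintype V] (G : Digraph V) (hG : G.IsUpwardOuterplanar)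
    (hblocks : ∀ B : Set V, G.toSimpleGraphInclusive.IsBlock B →
      (G.induceOn B).IsSTOuterplanar) :
    Nonempty (G.UpwardBookEmbedding 8) := by
  have hloc : ∀ S : Set V, (G.toSimpleGraphInclusive.induce S).IsNonseparable →
      HasLocalLayout G.Adj S := fun S hS => by
    -- By finiteness a nonseparable set lies in a block, and local layouts restrict to subsets.
    obtain ⟨B, hSB, hB⟩ := (Set.toFinite
      {S : Set V | (G.toSimpleGraphInclusive.induce S).IsNonseparable}).exists_le_maximal hS
    exact (Digraph.hasLocalLayout_of_induceOn
      (hG.hasLocalLayout_induceOn B (hblocks B hB).1)).mono hSB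
  rcases isEmpty_or_nonempty V with hV | ⟨⟨r⟩⟩
  · have : IsUpwardLayout G.Adj Set.univ (fun _ => 0) (fun _ _ => (0 : Fin 8)) :=
      ⟨fun u => hV.elim u, fun u => hV.elim u, fun u => hV.elim u⟩
    exact this.nonempty_upwardBookEmbedding
  · obtain ⟨p, σ, h⟩ := exists_isRootedLayout
      (fun u v => Digraph.toSimpleGraphInclusive_adj_of_adj hG.irrefl) hloc Set.univ r trivial ∅
      (by simp)
    exact h.toIsUpwardLayout.nonempty_upwardBookEmbedding
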